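/- Let $G=(V,E)$ be a finite simple graph with $n=|V|$ vertices. Its fractional chromatic number is $$\chi_f(G)=\min\{\mathbf 1^{\top}q \mid Fq=\mathbf 1,\ q\ge 0\},$$ where $F$ is the $0$-$1$ incidence matrix whose rows are indexed by $V$ and whose columns are indexed by the independent sets of $G$. $G$ is a circle graph if its vertices can be represented by chords of a circle with mutually distinct terminal points such that two distinct vertices are adjacent if and only if their chords intersect. An interval representation of $G$ consists of intervals $I(j)=[l_j,r_j]$, $l_j<r_j$ $(j\in V)$, with mutually distinct terminal points, such that two vertices are adjacent if and only if their intervals intersect and neither contains the other. Given an interval representation, let $P$ be the set of the terminal points of the intervals, let $\Gamma$ be the directed graph on $V\cup\{0\}$ with arc set $A=\{(0,i)\mid i\in V\}\cup\{(i,j)\mid I(i)\supsetneq I(j)\}$, let $V^i=\{j\in V\mid (i,j)\in A\}$ for $i\in V\cup\{0\}$, and let $V^{\bullet}=\{i\in V\mid V^i\ne\emptyset\}$. Let $M\in\{0,1\}^{P\times V}$ be the matrix with $m_{pj}=1$ if and only if $p\in I(j)$, let $M^i$ be the submatrix of the columns of $M$ indexed by $V^i$, and for $x\in\mathbb R^A$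 let $x^i=(x^i_j)_{j\in V^i}$ be the subvector indexed by the arcs leaving $i$. The integer program CG is $$\min c\quad\text{s.t.}\quad Mx^0\le c\mathbf 1,\quad M^ix^i\le\mathbf 1\ (\forall i\in V^{\bullet}),\quad \sum_{i:(i,j)\in A}x^i_j=1\ (\forall j\in V),\quad x\in\{0,1\}^A,\quad c\in\mathbb Z_{\ge 0},$$ and LR is its linear relaxation, obtained by replacing the last two conditions by $x\ge 0$ and $c\ge 0$ ($x \in \mathbb R^A$, $c\in\mathbb R$). Theorem. $G$ is a circle graph if and only if it has an interval representation. For every interval representation of $G$, the optimal value of LR is attained and equals $\chi_f(G)$. Moreover LR is a linear program of polynomial size: it has $|A|+1\le \frac{n(n+1)}2+1$ variables and, apart from the nonnegativity of the variables, $|P|(|V^{\bullet}|+1)+|V|\le 2n^2+n$ constraints, and all its coefficients and right-hand sides (after moving $c$ to the left-hand side) lie in $\{-1,0,1\}$. -/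

import Mathlib

open Matrix

noncomputable section

/-- A circle graph: its vertices are chords of a circle with mutually distinct terminal points
(chord `i` joins `a i` and `b i`), and distinct vertices are adjacent exactly when their chords
intersect. -/
def IsCircleGraph {V : Type*} (G : SimpleGraph V) : Prop :=
  ∃ a b : V → Circle, Function.Injective (Sum.elim a b) ∧
    ∀ i j : V, i ≠ j →
      (G.Adj i j ↔
        (segment ℝ (a i : ℂ) (b i : ℂ) ∩ segment ℝ (a j : ℂ) (b j : ℂ)).Nonempty)

/-- An interval (overlap) representation of `G`: intervals `I(j) = [l j, r j]` with mutually
distinct terminal points, such that two vertices are adjacent exactly when their intervals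
intersect and neither contains the other. -/
structure IntervalRepresentation {V : Type*} (G : SimpleGraph V) where
  l : V → ℝ
  r : V → ℝ
  l_lt_r : ∀ j, l j < r j
  terminals_distinct : Function.Injective (Sum.elim l r)
  adj_iff : ∀ i j : V, G.Adj i j ↔
    (Set.Icc (l i) (r i) ∩ Set.Icc (l j) (r j)).Nonempty ∧
      ¬ Set.Icc (l i) (r i) ⊆ Set.Icc (l j) (r j) ∧
      ¬ Set.Icc (l j) (r j) ⊆ Set.Icc (l i) (r i)

/-- The set of independent sets of `G`. -/
abbrev IndepSets {V : Type*} (G : SimpleGraph V) : Type _ := {S : Finset V // G.IsIndepSet (S : Set V)}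

instance {V : Type*} [Fintype V] (G : SimpleGraph V) : Fintype (IndepSets G) :=
  haveI : Finite (IndepSets G) := inferInstanceAs (Finite {_S : Finset V // _})
  Fintype.ofFinite _

open Classical in
/-- The incidence matrix `F` of independent sets: rows are vertices, columns are
independent sets. -/
def indepIncidence {V : Type*} (G : SimpleGraph V) : Matrix V (IndepSets G) ℝ :=
  fun v S => if v ∈ S.1 then 1 else 0

/-- The fractional chromatic number: the optimal value of
`min { 1ᵀ q | F q = 1, q ≥ 0 }`. -/
def fractionalChromaticNumber {V : Type*} [Fintype V] (G : SimpleGraph V) : ℝ :=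
  sInf {t : ℝ | ∃ q : IndepSets G → ℝ,
    indepIncidence G *ᵥ q = (fun _ => 1) ∧ (∀ S, 0 ≤ q S) ∧ t = ∑ S, q S}

namespace IntervalRepresentation

variable {V : Type*} {G : SimpleGraph V} (R : IntervalRepresentation G)

/-- The interval `I(j)`. -/
def I (j : V) : Set ℝ := Set.Icc (R.l j) (R.r j)

/-- `R.IsArc i j`: the pair `(i, j)` is an arc of the directed graph `Γ` on `V ∪ {0}`.
The root `0` is `none`; there is an arc from the root to every vertex, and an arc from `i` to `j`
when `I(i)` strictly contains `I(j)`. -/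
def IsArc : Option V → V → Prop
  | none, _ => True
  | some i, j => R.I j ⊂ R.I i

/-- The arc set `A` of `Γ`. -/
abbrev Arc : Type _ := {a : Option V × V // R.IsArc a.1 a.2}

/-- `Vⁱ`, the set of heads of the arcs leaving `i`. -/
abbrev Out (i : Option V) : Type _ := {j : V // R.IsArc i j}

/-- The set of the non-root vertices of `Γ` with an outgoing arc (written `V•`). -/
abbrev Inner : Type _ := {i : V // Nonempty (R.Out (some i))}

/-- The set `P` of terminal points. -/
abbrev Terminal : Type := {p : ℝ // p ∈ Set.range R.l ∪ Set.range R.r}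

section Finiteness

variable [Fintype V]

instance : Fintype R.Arc :=
  haveI : Finite R.Arc := inferInstanceAs (Finite {_a : Option V × V // _})
  Fintype.ofFinite _

instance (i : Option V) : Fintype (R.Out i) :=
  haveI : Finite (R.Out i) := inferInstanceAs (Finite {_j : V // _})
  Fintype.ofFinite _

end Finiteness

open Classical in
/-- The matrix `M`, indexed by `P × V`: the entry at `(p, j)` is `1` if `p ∈ I(j)`
and `0` otherwise. -/
def M : Matrix R.Terminal V ℝ := fun p j => if p.1 ∈ R.I j then 1 else 0

/-- `Mⁱ`, the submatrix of `M` of the columns indexed by `Vⁱ`. -/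
def subM (i : Option V) : Matrix R.Terminal (R.Out i) ℝ := fun p j => R.M p j.1

/-- `xⁱ`, the subvector of `x` indexed by the arcs emanating from `i`. -/
def subvec (x : R.Arc → ℝ) (i : Option V) : R.Out i → ℝ := fun j => x ⟨(i, j.1), j.2⟩

variable [Fintype V]

open Classical in
/-- The linear constraints of CG: `M x⁰ ≤ c 1`; `Mⁱ xⁱ ≤ 1` for every `i ∈ V•`; and
for every vertex `j`, the sum of `x` over the arcs entering `j` is `1`. -/
structure CGConstraints (x : R.Arc → ℝ) (c : ℝ) : Prop where
  root : ∀ p, (R.subM none *ᵥ R.subvec x none) p ≤ c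
  inner : ∀ i : R.Inner, ∀ p, (R.subM (some i.1) *ᵥ R.subvec x (some i.1)) p ≤ 1
  parent : ∀ j : V, ∑ a : R.Arc with a.1.2 = j, x a = 1

/-- Feasibility for the integer linear program CG (minimize `c`): the variables `x` are 0-1
and `c` is a nonnegative integer. -/
structure IsCGFeasible (x : R.Arc → ℝ) (c : ℝ) : Prop extends R.CGConstraints x c where
  x_binary : ∀ a, x a = 0 ∨ x a = 1
  c_integral : ∃ n : ℕ, c = n

/-- Feasibility for the linear relaxation LR of CG (minimize `c`): the integrality conditions
are replaced by `x ≥ 0` and `c ≥ 0`. -/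
structure IsLRFeasible (x : R.Arc → ℝ) (c : ℝ) : Prop extends R.CGConstraints x c where
  x_nonneg : ∀ a, 0 ≤ x a
  c_nonneg : 0 ≤ c

end IntervalRepresentation

/-- A linear program `min costᵀ z` subject to `A z ≤ b`, `E z = d`, `z ≥ 0`, with variables
indexed by `ι`, inequality constraints by `κ` and equality constraints by `μ`. -/
structure LinearProgram (ι κ μ : Type*) where
  cost : ι → ℝ
  A : Matrix κ ι ℝ
  b : κ → ℝ
  E : Matrix μ ι ℝ
  d : μ → ℝ

namespace LinearProgram

variable {ι κ μ : Type*}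

/-- Feasible solutions of a linear program. -/
def IsFeasible [Fintype ι] (L : LinearProgram ι κ μ) (z : ι → ℝ) : Prop :=
  (∀ k, (L.A *ᵥ z) k ≤ L.b k) ∧ L.E *ᵥ z = L.d ∧ ∀ v, 0 ≤ z v

/-- All the numbers occurring in the linear program are `-1`, `0` or `1`. -/
def HasUnitData (L : LinearProgram ι κ μ) : Prop :=
  (∀ v, L.cost v ∈ ({-1, 0, 1} : Set ℝ)) ∧ (∀ k v, L.A k v ∈ ({-1, 0, 1} : Set ℝ)) ∧
    (∀ k, L.b k ∈ ({-1, 0, 1} : Set ℝ)) ∧ (∀ m v, L.E m v ∈ ({-1, 0, 1} : Set ℝ)) ∧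
    ∀ m, L.d m ∈ ({-1, 0, 1} : Set ℝ)

end LinearProgram

namespace IntervalRepresentation

open Classical in
/-- LR written out with its coefficient matrices. The variables are `c` (index `none`) and
`x a` for the arcs `a`. The inequality with index `(none, p)` is the row `p` of `M x⁰ - c 1 ≤ 0`,
the one with index `(some i, p)` is the row `p` of `Mⁱ xⁱ ≤ 1`. -/
def lrProgram {V : Type*} {G : SimpleGraph V} (R : IntervalRepresentation G) :
    LinearProgram (Option R.Arc) (Option R.Inner × R.Terminal) V where
  cost := fun v => v.elim 1 (fun _ => 0)
  A := fun k v => v.elim (if k.1 = none then -1 else 0)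
    (fun a => if a.1.1 = k.1.map Subtype.val then R.M k.2 a.1.2 else 0)
  b := fun k => if k.1 = none then 0 else 1
  E := fun j v => v.elim 0 (fun a => if a.1.2 = j then 1 else 0)
  d := fun _ => 1

end IntervalRepresentation

end

/-! Cutting the circle at a point turns chords into pairs of reals. Two chords meet exactly when
their ends separate each other, and two intervals overlap exactly when theirs do; both amount to
`crossing` being negative.

For the value of LR, an independent set is a family of pairwise nested or disjoint intervals, so it
is a forest: the parent of a member is the smallest member strictly containing it, or the root, and
siblings are disjoint. Averaging the parent-child indicators over a fractional coloring of weight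
`c` gives a feasible `x` of value `c`: the children of `i` load a point by at most the weight of the
sets containing `i`, which is 1 for a vertex and `c` for the root (`exists_isLRFeasible`).

Conversely, intervals form a perfect system: a load of at most `C` splits into disjoint families of
total mass `C` (`exists_disjoint_families_of_load_le`). So every node gets a measure on disjoint
sets of children with marginals `x`. Let all nodes choose independently; the vertices reached from
the root form an independent set. Whether `i` is reached does not depend on its own choice, so by
induction from large to small intervals the weight with which `j` is reached is the sum of `x` over
the arcs entering `j`, which is 1 (`sum_weight_reached_eq_one`). The total mass is `c`. -/

/-! ### Crossing chords and overlapping intervals -/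

section CircleGraph

/-- The orientation (twice the signed area) of the triangle `p q r` in the plane. -/
def orientation (p q r : ℂ) : ℝ :=
  (q.re - p.re) * (r.im - p.im) - (q.im - p.im) * (r.re - p.re)

theorem orientation_lineMap (p q : ℂ) {z w : ℂ} (a b : ℝ) (hab : a + b = 1) :
    orientation p q (a • z + b • w) = a * orientation p q z + b * orientation p q w := by
  obtain rfl : b = 1 - a := by linarith
  simp [orientation]
  ring

theorem orientation_eq_zero_of_mem_segment {p q z : ℂ} (hz : z ∈ segment ℝ p q) :
    orientation p q z = 0 := by
  obtain ⟨a, b, -, -, hab, rfl⟩ := hz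
  rw [orientation_lineMap p q a b hab]
  simp only [orientation]
  ring

/-- `r` and `s` lie strictly on the same side of the line through `p` and `q`, and an affine
function keeps its sign on the segment between them. -/
theorem segment_inter_eq_empty {p q r s : ℂ} (h : 0 < orientation p q r * orientation p q s) :
    ¬ (segment ℝ p q ∩ segment ℝ r s).Nonempty := by
  rintro ⟨z, hz, a, b, ha, hb, hab, rfl⟩
  have h0 := orientation_eq_zero_of_mem_segment hz
  rw [orientation_lineMap p q a b hab] at h0
  have h1 : a * (orientation p q r) ^ 2 + b * (orientation p q r * orientation p q s) = 0 := by
    linear_combination orientation p q r * h0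
  have hr : 0 < orientation p q r ^ 2 := by
    have : orientation p q r ≠ 0 := by
      intro h'
      simp [h'] at h
    positivity
  have ha' : 0 ≤ a * orientation p q r ^ 2 := by positivity
  have hb' : 0 ≤ b * (orientation p q r * orientation p q s) := by positivity
  have ea : a = 0 := by
    rcases mul_eq_zero.1 (by linarith : a * orientation p q r ^ 2 = 0) with h | h
    · exact h
    · exact absurd h hr.ne'
  have eb : b = 0 := by
    rcases mul_eq_zero.1 (by linarith : b * (orientation p q r * orientation p q s) = 0) with h' | h'
    · exact h'
    · exact absurd h' h.ne'
  linarith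

/-- The weights `-v / (u - v)` and `u / (u - v)` are a convex combination if `u * v < 0`. -/
theorem convex_weights {u v : ℝ} (h : u * v < 0) :
    u - v ≠ 0 ∧ 0 ≤ -v / (u - v) ∧ 0 ≤ u / (u - v) ∧ -v / (u - v) + u / (u - v) = 1 := by
  have hne : u - v ≠ 0 := by
    intro h'
    obtain rfl : u = v := by linarith
    nlinarith [mul_self_nonneg u]
  refine ⟨hne, ?_, ?_, ?_⟩
  · rcases mul_neg_iff.1 h with ⟨hu, hv⟩ | ⟨hu, hv⟩
    · exact div_nonneg (by linarith) (by linarith)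
    · exact div_nonneg_of_nonpos (by linarith) (by linarith)
  · rcases mul_neg_iff.1 h with ⟨hu, hv⟩ | ⟨hu, hv⟩
    · exact div_nonneg (by linarith) (by linarith)
    · exact div_nonneg_of_nonpos (by linarith) (by linarith)
  · field_simp
    ring

theorem segment_inter_nonempty {p q r s : ℂ} (h : orientation p q r * orientation p q s < 0)
    (h' : orientation r s p * orientation r s q < 0) :
    (segment ℝ p q ∩ segment ℝ r s).Nonempty := by
  obtain ⟨hne, h1, h2, h3⟩ := convex_weights h
  obtain ⟨hne', h1', h2', h3'⟩ := convex_weights h'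
  refine ⟨_, ⟨_, _, h1', h2', h3', rfl⟩, ⟨_, _, h1, h2, h3, ?_⟩⟩
  -- Both differences are, up to sign, the cross product of `q - p` and `s - r`, so the two
  -- candidate points have a common denominator.
  have key : orientation r s p - orientation r s q
      = -(orientation p q r - orientation p q s) := by
    simp only [orientation]; ring
  rw [key] at hne' ⊢
  generalize hd : orientation p q r - orientation p q s = d at *
  apply Complex.ext
  · simp only [Complex.add_re, Complex.real_smul, Complex.mul_re, Complex.ofReal_re,
      Complex.ofReal_im, zero_mul, sub_zero]
    field_simp
    simp only [orientation]
    ring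
  · simp only [Complex.add_im, Complex.real_smul, Complex.mul_im, Complex.ofReal_re,
      Complex.ofReal_im, zero_mul, add_zero]
    field_simp
    simp only [orientation]
    ring

/-- In this product of sines of half differences, the sign depends only on the order of the angles,
as long as they lie in one period. -/
theorem orientation_circleExp (a b c : ℝ) :
    orientation (Circle.exp a) (Circle.exp b) (Circle.exp c)
      = 4 * Real.sin ((b - a) / 2) * Real.sin ((c - b) / 2) * Real.sin ((c - a) / 2) := by
  obtain ⟨u, rfl⟩ : ∃ u, b = a + 2 * u := ⟨(b - a) / 2, by ring⟩
  obtain ⟨v, rfl⟩ : ∃ v, c = a + 2 * u + 2 * v := ⟨(c - (a + 2 * u)) / 2, by ring⟩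
  have e1 : (a + 2 * u - a) / 2 = u := by ring
  have e2 : (a + 2 * u + 2 * v - (a + 2 * u)) / 2 = v := by ring
  have e3 : (a + 2 * u + 2 * v - a) / 2 = u + v := by ring
  rw [e1, e2, e3]
  simp only [orientation, Circle.coe_exp, Complex.exp_ofReal_mul_I_re, Complex.exp_ofReal_mul_I_im]
  have hx : ∀ x y : ℝ, (Real.cos (x + y) - Real.cos x) = -2 * Real.sin (x + y / 2) * Real.sin (y / 2) := by
    intro x y
    rw [Real.cos_sub_cos]; ring_nf
  have hy : ∀ x y : ℝ, (Real.sin (x + y) - Real.sin x) = 2 * Real.sin (y / 2) * Real.cos (x + y / 2) := by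
    intro x y
    rw [Real.sin_sub_sin]; ring_nf
  rw [add_assoc a, hx, hx, hy, hy]
  have e4 : 2 * u / 2 = u := by ring
  have e5 : (2 * u + 2 * v) / 2 = u + v := by ring
  rw [e4, e5]
  have : Real.sin v = Real.sin ((a + (u + v)) - (a + u)) := by ring_nf
  rw [this, Real.sin_sub]
  ring

theorem sign_sin_half {x : ℝ} (h : |x| < 2 * Real.pi) : SignType.sign (Real.sin (x / 2)) = SignType.sign x := by
  obtain ⟨h1, h2⟩ := abs_lt.1 h
  rcases lt_trichotomy x 0 with hx | rfl | hx
  · rw [sign_neg hx, sign_neg (Real.sin_neg_of_neg_of_neg_pi_lt (by linarith) (by linarith))]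
  · simp
  · rw [sign_pos hx, sign_pos (Real.sin_pos_of_pos_of_lt_pi (by linarith) (by linarith))]

/-- The product whose sign tells whether the pairs `a, b` and `c, d` separate each other. -/
def crossing (a b c d : ℝ) : ℝ := (c - a) * (c - b) * (d - a) * (d - b)

theorem crossing_comm (a b c d : ℝ) : crossing a b c d = crossing c d a b := by
  simp only [crossing]; ring

theorem sign_orientation_mul {a b c d : ℝ} (ha : a ∈ Set.Ioc (-Real.pi) Real.pi)
    (hb : b ∈ Set.Ioc (-Real.pi) Real.pi) (hc : c ∈ Set.Ioc (-Real.pi) Real.pi)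
    (hd : d ∈ Set.Ioc (-Real.pi) Real.pi) (hab : a ≠ b) :
    SignType.sign (orientation (Circle.exp a) (Circle.exp b) (Circle.exp c)
      * orientation (Circle.exp a) (Circle.exp b) (Circle.exp d))
      = SignType.sign (crossing a b c d) := by
  have key : ∀ x ∈ Set.Ioc (-Real.pi) Real.pi, ∀ y ∈ Set.Ioc (-Real.pi) Real.pi,
      SignType.sign (Real.sin ((x - y) / 2)) = SignType.sign (x - y) := by
    intro x hx y hy
    refine sign_sin_half (abs_lt.2 ⟨?_, ?_⟩)
    · linarith [hx.1, hy.2]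
    · linarith [hx.2, hy.1]
  have hs : Real.sin ((b - a) / 2) ≠ 0 := by
    rw [← sign_ne_zero, key b hb a ha, sign_ne_zero, sub_ne_zero]
    exact hab.symm
  -- The factor belonging to the chord `a b` itself occurs squared and does not affect the sign.
  have e : ∀ s x y z w : ℝ, (4 * s * x * y) * (4 * s * z * w) = (4 * s) ^ 2 * (y * x * w * z) := by
    intros; ring
  rw [orientation_circleExp, orientation_circleExp, e, sign_mul, sign_pos (by positivity), one_mul,
    crossing]
  simp only [sign_mul, key _ hc _ ha, key _ hc _ hb, key _ hd _ ha, key _ hd _ hb]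

/-- As `crossing` is symmetric in the two pairs, a negative value means that each chord separates
the ends of the other. -/
theorem chords_intersect_iff {a b c d : ℝ} (ha : a ∈ Set.Ioc (-Real.pi) Real.pi)
    (hb : b ∈ Set.Ioc (-Real.pi) Real.pi) (hc : c ∈ Set.Ioc (-Real.pi) Real.pi)
    (hd : d ∈ Set.Ioc (-Real.pi) Real.pi) (hab : a ≠ b) (hcd : c ≠ d) (hac : a ≠ c) (had : a ≠ d)
    (hbc : b ≠ c) (hbd : b ≠ d) :
    (segment ℝ (Circle.exp a : ℂ) (Circle.exp b) ∩ segment ℝ (Circle.exp c : ℂ) (Circle.exp d)).Nonempty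
      ↔ crossing a b c d < 0 := by
  have h1 := sign_orientation_mul ha hb hc hd hab
  have h2 := sign_orientation_mul hc hd ha hb hcd
  rw [← crossing_comm] at h2
  constructor
  · intro h
    by_contra hn
    have hne : crossing a b c d ≠ 0 := by
      simp only [crossing, ne_eq, mul_eq_zero, sub_eq_zero, not_or]
      exact ⟨⟨⟨hac.symm, hbc.symm⟩, had.symm⟩, hbd.symm⟩
    have hpos : 0 < crossing a b c d := lt_of_le_of_ne (not_lt.1 hn) hne.symm
    rw [sign_pos hpos, sign_eq_one_iff] at h1
    exact segment_inter_eq_empty h1 h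
  · intro h
    rw [sign_neg h, sign_eq_neg_one_iff] at h1 h2
    exact segment_inter_nonempty h1 h2

theorem overlap_iff {a b c d : ℝ} (hab : a < b) (hcd : c < d) (hac : a ≠ c) (had : a ≠ d)
    (hbc : b ≠ c) (hbd : b ≠ d) :
    ((Set.Icc a b ∩ Set.Icc c d).Nonempty ∧ ¬ Set.Icc a b ⊆ Set.Icc c d ∧
      ¬ Set.Icc c d ⊆ Set.Icc a b) ↔ crossing a b c d < 0 := by
  rw [Set.Icc_subset_Icc_iff hab.le, Set.Icc_subset_Icc_iff hcd.le, Set.Icc_inter_Icc,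
    Set.nonempty_Icc, sup_le_iff, le_inf_iff, le_inf_iff]
  -- The first factor is negative exactly for nested intervals, and then the second is negative too.
  -- If the first is positive, the second is negative exactly when the intervals meet.
  have e : crossing a b c d = ((c - a) * (d - b)) * ((c - b) * (d - a)) := by
    simp only [crossing]; ring
  have hpos : ∀ {x y : ℝ}, 0 < x → (x * y < 0 ↔ y < 0) := fun hx =>
    ⟨fun h => not_le.1 fun hn => h.not_ge (mul_nonneg hx.le hn), mul_neg_of_pos_of_neg hx⟩
  have hda : ∀ {x y : ℝ}, 0 < y → (x * y < 0 ↔ x < 0) := fun hy => by rw [mul_comm, hpos hy]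
  have hcb : ∀ {x y : ℝ}, x < 0 → (x * y < 0 ↔ 0 < y) := fun {x y} hx => by
    rw [← neg_mul_neg, hpos (neg_pos.2 hx), neg_lt_zero]
  rw [e]
  rcases lt_or_gt_of_ne hac with h1 | h1 <;> rcases lt_or_gt_of_ne hbd with h2 | h2
  · rw [hpos (mul_pos (by linarith) (by linarith)),
      hda (by linarith)]
    refine ⟨fun h => ?_, fun h => ⟨⟨⟨hab.le, by linarith⟩, by linarith, hcd.le⟩, ?_, ?_⟩⟩
    · exact sub_neg.2 (lt_of_le_of_ne h.1.2.1 hbc.symm)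
    · rintro ⟨h3, -⟩; linarith
    · rintro ⟨-, h3⟩; linarith
  · have : 0 < (c - a) * (d - b) * ((c - b) * (d - a)) :=
      mul_pos_of_neg_of_neg (mul_neg_of_pos_of_neg (by linarith) (by linarith))
        (mul_neg_of_neg_of_pos (by linarith) (by linarith))
    exact ⟨fun h => absurd ⟨h1.le, h2.le⟩ h.2.2, fun h => absurd h this.not_gt⟩
  · have : 0 < (c - a) * (d - b) * ((c - b) * (d - a)) :=
      mul_pos_of_neg_of_neg (mul_neg_of_neg_of_pos (by linarith) (by linarith))
        (mul_neg_of_neg_of_pos (by linarith) (by linarith))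
    exact ⟨fun h => absurd ⟨h1.le, h2.le⟩ h.2.1, fun h => absurd h this.not_gt⟩
  · rw [hpos (mul_pos_of_neg_of_neg (by linarith) (by linarith)),
      hcb (by linarith)]
    refine ⟨fun h => ?_, fun h => ⟨⟨⟨hab.le, by linarith⟩, by linarith, hcd.le⟩, ?_, ?_⟩⟩
    · exact sub_pos.2 (lt_of_le_of_ne h.1.1.2 had)
    · rintro ⟨-, h3⟩; linarith
    · rintro ⟨h3, -⟩; linarith

theorem crossing_neg_iff_of_strictMono {f : ℝ → ℝ} (hf : StrictMono f) (a b c d : ℝ) :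
    crossing (f a) (f b) (f c) (f d) < 0 ↔ crossing a b c d < 0 := by
  have key : ∀ x y : ℝ, SignType.sign (f x - f y) = SignType.sign (x - y) := by
    intro x y
    rcases lt_trichotomy x y with h | rfl | h
    · rw [sign_neg (sub_neg.2 (hf h)), sign_neg (sub_neg.2 h)]
    · simp
    · rw [sign_pos (sub_pos.2 (hf h)), sign_pos (sub_pos.2 h)]
  rw [← sign_eq_neg_one_iff, ← sign_eq_neg_one_iff]
  simp only [crossing, sign_mul, key]

variable {V : Type*} {G : SimpleGraph V}

theorem IntervalRepresentation.adj_iff_crossing (R : IntervalRepresentation G) {i j : V}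
    (hij : i ≠ j) : G.Adj i j ↔ crossing (R.l i) (R.r i) (R.l j) (R.r j) < 0 := by
  have hd := R.terminals_distinct
  have hl : R.l i ≠ R.l j := fun h => hij (Sum.inl_injective (@hd (.inl i) (.inl j) h))
  have hr : R.r i ≠ R.r j := fun h => hij (Sum.inr_injective (@hd (.inr i) (.inr j) h))
  have hlr : ∀ x y, R.l x ≠ R.r y := fun x y h => by simpa using @hd (.inl x) (.inr y) h
  rw [R.adj_iff, overlap_iff (R.l_lt_r i) (R.l_lt_r j) hl (hlr i j) (hlr j i).symm hr]

theorem isCircleGraph_of_intervalRepresentation (R : IntervalRepresentation G) :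
    IsCircleGraph G := by
  -- An increasing map of the line into an open period of `Circle.exp`.
  let f : ℝ → ℝ := fun t => 2 * Real.arctan t
  have hf : StrictMono f := fun x y h => mul_lt_mul_of_pos_left (Real.arctan_strictMono h) two_pos
  have hmem : ∀ t, f t ∈ Set.Ioc (-Real.pi) Real.pi := fun t => by
    have h1 := Real.neg_pi_div_two_lt_arctan t
    have h2 := Real.arctan_lt_pi_div_two t
    constructor <;> simp only [f] <;> linarith
  have hinj : Set.InjOn (fun t => Circle.exp t) (Set.Ioc (-Real.pi) Real.pi) := by
    intro x hx y hy h
    have h' : (Circle.exp x : ℂ).arg = (Circle.exp y : ℂ).arg :=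
      congrArg (fun z : Circle => (z : ℂ).arg) h
    rwa [Circle.arg_exp hx.1 hx.2, Circle.arg_exp hy.1 hy.2] at h'
  refine ⟨fun v => Circle.exp (f (R.l v)), fun v => Circle.exp (f (R.r v)), ?_, ?_⟩
  · have : Sum.elim (fun v => Circle.exp (f (R.l v))) (fun v => Circle.exp (f (R.r v)))
        = fun s => Circle.exp (f (Sum.elim R.l R.r s)) := by
      ext s; cases s <;> rfl
    rw [this]
    intro s t h
    exact R.terminals_distinct (hf.injective (hinj (hmem _) (hmem _) h))
  · intro i j hij
    have hd := hf.injective.comp R.terminals_distinct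
    have h1 : f (R.l i) ≠ f (R.l j) := fun h => hij (Sum.inl_injective (@hd (.inl i) (.inl j) h))
    have h2 : f (R.r i) ≠ f (R.r j) := fun h => hij (Sum.inr_injective (@hd (.inr i) (.inr j) h))
    have h3 : ∀ x y, f (R.l x) ≠ f (R.r y) := fun x y h => by simpa using @hd (.inl x) (.inr y) h
    rw [chords_intersect_iff (hmem _) (hmem _) (hmem _) (hmem _) (h3 i i) (h3 j j) h1 (h3 i j)
      (h3 j i).symm h2, crossing_neg_iff_of_strictMono hf, R.adj_iff_crossing hij]

theorem nonempty_intervalRepresentation_of_isCircleGraph (h : IsCircleGraph G) :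
    Nonempty (IntervalRepresentation G) := by
  obtain ⟨a, b, hinj, hadj⟩ := h
  let A : V → ℝ := fun v => (a v : ℂ).arg
  -- The argument cuts the circle at `-1`. Sorting the two ends of a chord by `min` and `max` leaves
  -- `crossing` unchanged.
  let B : V → ℝ := fun v => (b v : ℂ).arg
  have hexp : ∀ z : Circle, Circle.exp (z : ℂ).arg = z := Circle.exp_arg
  have hmem : ∀ z : Circle, (z : ℂ).arg ∈ Set.Ioc (-Real.pi) Real.pi := fun z =>
    Complex.arg_mem_Ioc _
  have hz : ∀ {z w : Circle}, z ≠ w → (z : ℂ).arg ≠ (w : ℂ).arg := fun {z w} hzw h =>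
    hzw (by rw [← hexp z, ← hexp w, h])
  have hne : ∀ {s t : V ⊕ V}, s ≠ t → Sum.elim A B s ≠ Sum.elim A B t := by
    intro s t hst
    have := hz (hinj.ne hst)
    cases s <;> cases t <;> exact this
  have hAB : ∀ v w, A v ≠ B w := fun v w => @hne (.inl v) (.inr w) (by simp)
  have hcase : ∀ v, (min (A v) (B v) = A v ∧ max (A v) (B v) = B v) ∨
      (min (A v) (B v) = B v ∧ max (A v) (B v) = A v) := fun v => by
    rcases le_total (A v) (B v) with h | h
    · exact .inl ⟨min_eq_left h, max_eq_right h⟩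
    · exact .inr ⟨min_eq_right h, max_eq_left h⟩
  have hlt : ∀ v, min (A v) (B v) < max (A v) (B v) := fun v => min_lt_max.2 (hAB v v)
  have hcross : ∀ i j, crossing (min (A i) (B i)) (max (A i) (B i)) (min (A j) (B j))
      (max (A j) (B j)) = crossing (A i) (B i) (A j) (B j) := by
    intro i j
    rcases hcase i with ⟨h1, h2⟩ | ⟨h1, h2⟩ <;> rcases hcase j with ⟨h3, h4⟩ | ⟨h3, h4⟩ <;>
      rw [h1, h2, h3, h4] <;> simp only [crossing] <;> ring
  have hmin : ∀ v, min (A v) (B v) = A v ∨ min (A v) (B v) = B v := fun v => min_choice _ _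
  have hmax : ∀ v, max (A v) (B v) = A v ∨ max (A v) (B v) = B v := fun v => max_choice _ _
  have hdist : ∀ {i j : V}, i ≠ j → ∀ x y : ℝ, (x = A i ∨ x = B i) → (y = A j ∨ y = B j) →
      x ≠ y := by
    rintro i j hij x y (rfl | rfl) (rfl | rfl)
    · exact @hne (.inl i) (.inl j) (by simpa using hij)
    · exact @hne (.inl i) (.inr j) (by simp)
    · exact @hne (.inr i) (.inl j) (by simp)
    · exact @hne (.inr i) (.inr j) (by simpa using hij)
  refine ⟨⟨fun v => min (A v) (B v), fun v => max (A v) (B v), hlt, ?_, ?_⟩⟩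
  · rintro (i | i) (j | j) h <;> by_cases hij : i = j
    · rw [hij]
    · exact absurd h (hdist hij _ _ (hmin i) (hmin j))
    · subst hij
      exact absurd h (hlt i).ne
    · exact absurd h (hdist hij _ _ (hmin i) (hmax j))
    · subst hij
      exact absurd h (hlt i).ne'
    · exact absurd h (hdist hij _ _ (hmax i) (hmin j))
    · rw [hij]
    · exact absurd h (hdist hij _ _ (hmax i) (hmax j))
  · intro i j
    by_cases hij : i = j
    · subst hij
      simp
    · rw [overlap_iff (hlt i) (hlt j) (hdist hij _ _ (hmin i) (hmin j))
        (hdist hij _ _ (hmin i) (hmax j)) (hdist hij _ _ (hmax i) (hmin j))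
        (hdist hij _ _ (hmax i) (hmax j)), hcross, hadj i j hij, ← hexp (a i), ← hexp (b i),
        ← hexp (a j), ← hexp (b j)]
      exact chords_intersect_iff (hmem _) (hmem _) (hmem _) (hmem _) (hAB i i) (hAB j j)
        (hdist hij _ _ (.inl rfl) (.inl rfl)) (hdist hij _ _ (.inl rfl) (.inr rfl))
        (hdist hij _ _ (.inr rfl) (.inl rfl)) (hdist hij _ _ (.inr rfl) (.inr rfl))

end CircleGraph

namespace IntervalRepresentation

/-! ### Nesting of the intervals -/

section Order

variable {V : Type*} {G : SimpleGraph V} (R : IntervalRepresentation G)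

theorem l_injective : Function.Injective R.l := fun _ _ h =>
  Sum.inl_injective (@R.terminals_distinct (.inl _) (.inl _) h)

theorem r_injective : Function.Injective R.r := fun _ _ h =>
  Sum.inr_injective (@R.terminals_distinct (.inr _) (.inr _) h)

theorem I_subset_iff {i j : V} : R.I j ⊆ R.I i ↔ R.l i ≤ R.l j ∧ R.r j ≤ R.r i :=
  Set.Icc_subset_Icc_iff (R.l_lt_r j).le

theorem I_injective : Function.Injective R.I := fun _ _ h =>
  R.l_injective (le_antisymm (R.I_subset_iff.1 h.ge).1 (R.I_subset_iff.1 h.le).1)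

theorem I_ssubset_iff {i j : V} : R.I j ⊂ R.I i ↔ R.l i < R.l j ∧ R.r j < R.r i := by
  constructor
  · intro h
    have hne : i ≠ j := by
      rintro rfl
      exact ssubset_irrefl _ h
    obtain ⟨h1, h2⟩ := R.I_subset_iff.1 h.subset
    exact ⟨lt_of_le_of_ne h1 (R.l_injective.ne hne), lt_of_le_of_ne h2 (R.r_injective.ne hne.symm)⟩
  · rintro ⟨h1, h2⟩
    exact ⟨R.I_subset_iff.2 ⟨h1.le, h2.le⟩, fun h => h1.not_ge (R.I_subset_iff.1 h).1⟩

theorem length_lt_of_ssubset {i j : V} (h : R.I j ⊂ R.I i) : R.r j - R.l j < R.r i - R.l i := by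
  obtain ⟨h1, h2⟩ := R.I_ssubset_iff.1 h
  linarith

theorem left_mem_I (j : V) : R.l j ∈ R.I j := Set.left_mem_Icc.2 (R.l_lt_r j).le

/-- Two vertices are not adjacent exactly if their intervals are disjoint, nested or equal. -/
theorem not_adj_iff {i j : V} :
    ¬ G.Adj i j ↔ ((R.I i ∩ R.I j).Nonempty → i = j ∨ R.I i ⊂ R.I j ∨ R.I j ⊂ R.I i) := by
  have hsub : ∀ i j, R.I i ⊆ R.I j ↔ i = j ∨ R.I i ⊂ R.I j := fun i j => by
    rw [subset_iff_ssubset_or_eq, R.I_injective.eq_iff, or_comm]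
  have h1 := hsub i j
  have h2 := hsub j i
  have h3 := R.adj_iff i j
  simp only [← I.eq_def] at h3
  rw [h3, h1, h2]
  have : i = j ↔ j = i := eq_comm
  tauto

end Order

/-! ### Coefficients and size of LR -/

section Size

open Classical

variable {V : Type*} {G : SimpleGraph V} (R : IntervalRepresentation G)

theorem hasUnitData_lrProgram : R.lrProgram.HasUnitData := by
  refine ⟨?_, ?_, ?_, ?_, ?_⟩
  · rintro (_ | a) <;> simp [lrProgram]
  · rintro ⟨k, p⟩ (_ | a)
    · simp only [lrProgram, Option.elim]
      split_ifs <;> simp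
    · simp only [lrProgram, Option.elim, M]
      split_ifs <;> simp
  · rintro ⟨k, p⟩
    simp only [lrProgram]
    split_ifs <;> simp
  · rintro m (_ | a)
    · simp [lrProgram]
    · simp only [lrProgram, Option.elim]
      split_ifs <;> simp
  · simp [lrProgram]

variable [Fintype V]

theorem sum_lrProgram_cost_mul (z : Option R.Arc → ℝ) :
    ∑ v, R.lrProgram.cost v * z v = z none := by
  simp [Fintype.sum_option, lrProgram]

theorem sum_arc_eq_sum_out (i : Option V) (F : R.Arc → ℝ) :
    ∑ a : R.Arc, (if a.1.1 = i then F a else 0) = ∑ j : R.Out i, F ⟨(i, j.1), j.2⟩ := by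
  rw [← Finset.sum_filter]
  symm
  refine Finset.sum_bij (fun j _ => ⟨(i, j.1), j.2⟩) ?_ ?_ ?_ ?_
  · simp
  · intro a _ b _ h
    simpa [Subtype.ext_iff] using h
  · rintro ⟨⟨i', j⟩, hj⟩ h
    obtain rfl : i' = i := by simpa using h
    exact ⟨⟨j, hj⟩, by simp⟩
  · simp

theorem subM_mulVec_subvec (i : Option V) (x : R.Arc → ℝ) (p : R.Terminal) :
    (R.subM i *ᵥ R.subvec x i) p
      = ∑ a : R.Arc, (if a.1.1 = i then R.M p a.1.2 else 0) * x a := by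
  simp only [ite_mul, zero_mul]
  rw [R.sum_arc_eq_sum_out i (fun a => R.M p a.1.2 * x a)]
  rfl

theorem isFeasible_lrProgram_iff (z : Option R.Arc → ℝ) :
    R.lrProgram.IsFeasible z ↔ R.IsLRFeasible (fun a => z (some a)) (z none) := by
  have hA : ∀ k : Option R.Inner × R.Terminal, (R.lrProgram.A *ᵥ z) k
      = (if k.1 = none then -1 else 0) * z none
        + (R.subM (k.1.map Subtype.val) *ᵥ R.subvec (fun a => z (some a)) (k.1.map Subtype.val))
          k.2 := by
    intro k
    rw [subM_mulVec_subvec]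
    simp [Matrix.mulVec, dotProduct, Fintype.sum_option, lrProgram]
  have hE : ∀ j : V, (R.lrProgram.E *ᵥ z) j = ∑ a : R.Arc with a.1.2 = j, z (some a) := by
    intro j
    rw [Finset.sum_filter]
    simp [Matrix.mulVec, dotProduct, Fintype.sum_option, lrProgram]
  constructor
  · rintro ⟨h1, h2, h3⟩
    refine ⟨⟨fun p => ?_, fun i p => ?_, fun j => ?_⟩, fun a => h3 _, h3 _⟩
    · have := h1 (none, p)
      rw [hA] at this
      simp only [if_true, Option.map_none, lrProgram] at this
      linarith
    · have := h1 (some i, p)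
      rw [hA] at this
      simpa [lrProgram] using this
    · rw [← hE, h2]
      rfl
  · rintro ⟨⟨h1, h2, h3⟩, h4, h5⟩
    refine ⟨?_, ?_, ?_⟩
    · rintro ⟨_ | i, p⟩
      · rw [hA]
        have := h1 p
        simp only [if_true, Option.map_none, lrProgram]
        linarith
      · rw [hA]
        simpa [lrProgram] using h2 i p
    · ext j
      rw [hE, h3]
      rfl
    · rintro (_ | a)
      · exact h5
      · exact h4 a

/-- Two copies of the arc set inject into `V × V ⊕ V`: a root arc goes to `V` and to the diagonal,
an arc `(i, j)` to itself and to its reverse. There is no clash because strict containment is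
irreflexive and asymmetric. The summand 2 counts the variable `c` twice. -/
theorem two_mul_card_arc_le :
    2 * Nat.card (Option R.Arc) ≤ Fintype.card V * (Fintype.card V + 1) + 2 := by
  let f : R.Arc ⊕ R.Arc → (V × V) ⊕ V := Sum.elim
    (fun a => a.1.1.elim (.inr a.1.2) fun i => .inl (i, a.1.2))
    (fun a => a.1.1.elim (.inl (a.1.2, a.1.2)) fun i => .inl (a.1.2, i))
  have hf : Function.Injective f := by
    rintro (⟨⟨_ | i, j⟩, h⟩ | ⟨⟨_ | i, j⟩, h⟩) (⟨⟨_ | i', j'⟩, h'⟩ | ⟨⟨_ | i', j'⟩, h'⟩) e <;>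
      simp only [f, Sum.elim_inl, Sum.elim_inr, Option.elim, Sum.inl.injEq, Sum.inr.injEq,
        Prod.mk.injEq, reduceCtorEq] at e
    · simp [e]
    · simp [e]
    · obtain ⟨rfl, rfl⟩ := e
      exact absurd h (ssubset_irrefl _)
    · obtain ⟨rfl, rfl⟩ := e
      exact absurd (ssubset_trans h h') (ssubset_irrefl _)
    · obtain ⟨rfl, rfl⟩ := e
      exact absurd h' (ssubset_irrefl _)
    · simp [e]
    · obtain ⟨rfl, rfl⟩ := e
      exact absurd h' (ssubset_irrefl _)
    · obtain ⟨rfl, rfl⟩ := e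
      exact absurd (ssubset_trans h h') (ssubset_irrefl _)
    · obtain ⟨rfl, rfl⟩ := e
      exact absurd h (ssubset_irrefl _)
    · simp [e]
  have := Fintype.card_le_of_injective f hf
  simp only [Fintype.card_sum, Fintype.card_prod] at this
  rw [Nat.card_eq_fintype_card, Fintype.card_option]
  linarith

theorem card_constraints_le :
    Nat.card (Option R.Inner × R.Terminal) + Nat.card V
      ≤ 2 * Fintype.card V ^ 2 + Fintype.card V := by
  have hT : Nat.card R.Terminal ≤ 2 * Fintype.card V := by
    have hs : Function.Surjective (Sum.elim (fun v => (⟨R.l v, .inl ⟨v, rfl⟩⟩ : R.Terminal))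
        (fun v => (⟨R.r v, .inr ⟨v, rfl⟩⟩ : R.Terminal))) := by
      rintro ⟨p, ⟨v, rfl⟩ | ⟨v, rfl⟩⟩
      · exact ⟨.inl v, rfl⟩
      · exact ⟨.inr v, rfl⟩
    have := Nat.card_le_card_of_surjective _ hs
    rw [Nat.card_sum, Nat.card_eq_fintype_card (α := V)] at this
    linarith
  rw [Nat.card_prod, Nat.card_eq_fintype_card (α := V)]
  rcases isEmpty_or_nonempty V with hV | hV
  · have h0 : Fintype.card V = 0 := Fintype.card_eq_zero
    have : Nat.card R.Terminal = 0 := by omega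
    rw [this, h0]
    rfl
  · have hI : Nat.card (Option R.Inner) ≤ Fintype.card V := by
      -- A shortest interval contains no other one, so its vertex is not in `R.Inner` and makes room
      -- for the root.
      obtain ⟨j, hj⟩ := Finite.exists_min (fun v => R.r v - R.l v)
      rw [Nat.card_eq_fintype_card, Fintype.card_option, Nat.succ_le_iff]
      refine Fintype.card_subtype_lt (x := j) ?_
      rintro ⟨k, hk⟩
      exact (hj k).not_gt (R.length_lt_of_ssubset hk)
    nlinarith [Nat.mul_le_mul hI hT]

end Size

end IntervalRepresentation

namespace IntervalRepresentation

/-! ### From fractional colorings to solutions of LR -/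

section ColoringToLR

open Classical

variable {V : Type*} {G : SimpleGraph V} (R : IntervalRepresentation G)

/-- `i` is the parent of `j` in the forest formed by the intervals of `S`: the smallest interval
of `S` that strictly contains `I j`, or the root `none` if there is no such interval. -/
def IsParent (S : Finset V) (i : Option V) (j : V) : Prop :=
  j ∈ S ∧ (∀ k ∈ i, k ∈ S) ∧ R.IsArc i j ∧ ∀ k ∈ S, R.I j ⊂ R.I k → ¬ R.IsArc i k

variable {R}

theorem trichotomy_of_isIndepSet {S : Finset V} (hS : G.IsIndepSet (S : Set V)) {i j : V}
    (hi : i ∈ S) (hj : j ∈ S) (h : (R.I i ∩ R.I j).Nonempty) :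
    i = j ∨ R.I i ⊂ R.I j ∨ R.I j ⊂ R.I i := by
  by_cases hij : i = j
  · exact .inl hij
  · exact R.not_adj_iff.1 (hS hi hj hij) h

/-- Of two children of `i` that meet, the larger would lie strictly between the smaller and `i`. -/
theorem IsParent.head_unique {S : Finset V} (hS : G.IsIndepSet (S : Set V)) {i : Option V}
    {j k : V} (hj : R.IsParent S i j) (hk : R.IsParent S i k) (h : (R.I j ∩ R.I k).Nonempty) :
    j = k := by
  rcases trichotomy_of_isIndepSet hS hj.1 hk.1 h with h | h | h
  · exact h
  · exact absurd hk.2.2.1 (hj.2.2.2 k hk.1 h)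
  · exact absurd hj.2.2.1 (hk.2.2.2 j hj.1 h)

/-- Two vertex parents both contain `I j`, so they are equal or nested, and the larger of nested
ones is not the smallest above `j`. -/
theorem IsParent.unique {S : Finset V} (hS : G.IsIndepSet (S : Set V)) {i k : Option V}
    {j : V} (hi : R.IsParent S i j) (hk : R.IsParent S k j) : i = k := by
  rcases i with _ | i <;> rcases k with _ | k
  · rfl
  · exact absurd trivial (hi.2.2.2 k (hk.2.1 k rfl) hk.2.2.1)
  · exact absurd trivial (hk.2.2.2 i (hi.2.1 i rfl) hi.2.2.1)
  · have hiS := hi.2.1 i rfl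
    have hkS := hk.2.1 k rfl
    rcases trichotomy_of_isIndepSet (R := R) hS hiS hkS
      ⟨R.l j, hi.2.2.1.subset (R.left_mem_I j), hk.2.2.1.subset (R.left_mem_I j)⟩ with h | h | h
    · rw [h]
    · exact absurd h (hk.2.2.2 i hiS hi.2.2.1)
    · exact absurd h (hi.2.2.2 k hkS hk.2.2.1)

variable (R)

theorem exists_isParent {S : Finset V} {j : V} (hj : j ∈ S) : ∃ i, R.IsParent S i j := by
  rcases (S.filter fun k => R.I j ⊂ R.I k).eq_empty_or_nonempty with h | h
  · refine ⟨none, hj, by simp, trivial, fun k hk hjk => ?_⟩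
    exact absurd (Finset.mem_filter.2 ⟨hk, hjk⟩) (h ▸ Finset.notMem_empty k)
  · obtain ⟨i, hi, hmin⟩ := Finset.exists_min_image _ (fun k => R.r k - R.l k) h
    obtain ⟨hiS, hji⟩ := Finset.mem_filter.1 hi
    refine ⟨some i, hj, by simpa using hiS, hji, fun k hk hjk hik => ?_⟩
    exact (hmin k (Finset.mem_filter.2 ⟨hk, hjk⟩)).not_gt (R.length_lt_of_ssubset hik)

variable [Fintype V]

theorem sum_isParent_eq {S : Finset V} (hS : G.IsIndepSet (S : Set V)) (j : V) :
    ∑ a : R.Arc with a.1.2 = j, (if R.IsParent S a.1.1 a.1.2 then (1 : ℝ) else 0)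
      = if j ∈ S then 1 else 0 := by
  split_ifs with hj
  · obtain ⟨i, hi⟩ := R.exists_isParent hj
    rw [Finset.sum_eq_single ⟨(i, j), hi.2.2.1⟩]
    · simp [hi]
    · rintro ⟨⟨i', j'⟩, h⟩ hb hne
      obtain rfl : j' = j := by simpa using hb
      refine if_neg fun h' => hne ?_
      obtain rfl : i' = i := IsParent.unique hS h' hi
      rfl
    · simp
  · refine Finset.sum_eq_zero fun a ha => if_neg fun h => hj ?_
    rw [← (Finset.mem_filter.1 ha).2]
    exact h.1

/-- At most one child covers `p`, and a vertex has children only if it belongs to `S`. For the root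
the condition on the right is vacuous. -/
theorem sum_children_le {S : Finset V} (hS : G.IsIndepSet (S : Set V)) (i : Option V)
    (p : R.Terminal) :
    ∑ j : R.Out i, R.M p j.1 * (if R.IsParent S i j.1 then (1 : ℝ) else 0)
      ≤ if ∀ k ∈ i, k ∈ S then 1 else 0 := by
  by_cases h : ∃ j : R.Out i, p.1 ∈ R.I j.1 ∧ R.IsParent S i j.1
  · obtain ⟨j, hp, hj⟩ := h
    rw [if_pos hj.2.1, Finset.sum_eq_single j]
    · simp [M, hp, hj]
    · intro k _ hne
      by_contra hk
      simp only [M, mul_ite, mul_one, mul_zero, ite_eq_right_iff, Classical.not_imp] at hk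
      exact hne (Subtype.ext (IsParent.head_unique hS hk.1 hj ⟨p.1, hk.2.1, hp⟩))
    · simp
  · rw [Finset.sum_eq_zero]
    · split_ifs <;> simp
    · intro j _
      by_contra hj
      simp only [M, mul_ite, mul_one, mul_zero, ite_eq_right_iff, Classical.not_imp] at hj
      exact h ⟨j, hj.2.1, hj.1⟩

/-- A fractional coloring of weight `c` yields a feasible solution of LR of value `c`. -/
theorem exists_isLRFeasible (q : IndepSets G → ℝ) (hq : indepIncidence G *ᵥ q = fun _ => 1)
    (hq0 : ∀ S, 0 ≤ q S) : ∃ x, R.IsLRFeasible x (∑ S, q S) := by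
  have hcov : ∀ v, ∑ S : IndepSets G, (if v ∈ S.1 then 1 else 0) * q S = 1 := fun v =>
    congrFun hq v
  -- The weight of the sets in whose forest `a` is a parent-child pair.
  let x : R.Arc → ℝ := fun a =>
    ∑ S : IndepSets G, (if R.IsParent S.1 a.1.1 a.1.2 then 1 else 0) * q S
  have hrow : ∀ i p, (R.subM i *ᵥ R.subvec x i) p
      ≤ ∑ S : IndepSets G, (if ∀ k ∈ i, k ∈ S.1 then 1 else 0) * q S := by
    intro i p
    have : (R.subM i *ᵥ R.subvec x i) p = ∑ S : IndepSets G,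
        (∑ j : R.Out i, R.M p j.1 * (if R.IsParent S.1 i j.1 then (1 : ℝ) else 0)) * q S := by
      simp only [Matrix.mulVec, dotProduct, subM, subvec, x, Finset.mul_sum, Finset.sum_mul,
        mul_assoc]
      rw [Finset.sum_comm]
    rw [this]
    exact Finset.sum_le_sum fun S _ =>
      mul_le_mul_of_nonneg_right (R.sum_children_le S.2 i p) (hq0 S)
  refine ⟨x, ⟨fun p => ?_, fun i p => ?_, fun j => ?_⟩, fun a => ?_, ?_⟩
  · simpa using hrow none p
  · refine (hrow (some i.1) p).trans_eq ?_
    simpa using hcov i.1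
  · simp only [x]
    rw [Finset.sum_comm]
    refine Eq.trans ?_ (hcov j)
    refine Finset.sum_congr rfl fun S _ => ?_
    rw [← Finset.sum_mul, R.sum_isParent_eq S.2]
  · exact Finset.sum_nonneg fun S _ => mul_nonneg (by split_ifs <;> simp) (hq0 S)
  · exact Finset.sum_nonneg fun S _ => hq0 S

end ColoringToLR

end IntervalRepresentation

/-! ### Existence of an optimal fractional coloring -/

section Attained

open Classical in
/-- The minimum defining the fractional chromatic number is attained. -/
theorem isLeast_fractionalChromaticNumber {V : Type*} [Fintype V] (G : SimpleGraph V) :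
    IsLeast {t : ℝ | ∃ q : IndepSets G → ℝ,
      indepIncidence G *ᵥ q = (fun _ => 1) ∧ (∀ S, 0 ≤ q S) ∧ t = ∑ S, q S}
      (fractionalChromaticNumber G) := by
  set T : Set ℝ := {t : ℝ | ∃ q : IndepSets G → ℝ,
      indepIncidence G *ᵥ q = (fun _ => 1) ∧ (∀ S, 0 ≤ q S) ∧ t = ∑ S, q S} with hT
  have hne : T.Nonempty := by
    refine ⟨_, fun S => if S.1.card = 1 then 1 else 0, ?_, fun S => by dsimp only; split_ifs <;> simp, rfl⟩
    ext v
    have hv : G.IsIndepSet (({v} : Finset V) : Set V) := by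
      simp [SimpleGraph.IsIndepSet]
    simp only [Matrix.mulVec, dotProduct, indepIncidence]
    rw [Finset.sum_eq_single ⟨{v}, hv⟩]
    · simp
    · intro S _ hS
      by_contra h
      simp only [mul_ite, mul_one, mul_zero, ite_eq_right_iff, Classical.not_imp, one_ne_zero,
        not_false_eq_true, and_true] at h
      obtain ⟨w, hw⟩ := Finset.card_eq_one.1 h.1
      have : v = w := by simpa [hw] using h.2
      exact hS (Subtype.ext (hw.trans (congrArg _ this.symm)))
    · simp
  have hbdd : BddBelow T := ⟨0, by
    rintro t ⟨q, -, hq, rfl⟩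
    exact Finset.sum_nonneg fun S _ => hq S⟩
  obtain ⟨t₀, ht₀⟩ := hne
  -- Capping the coordinates at the value `t₀` of a known coloring gives compactness and discards
  -- only colorings heavier than `t₀`.
  let K : Set (IndepSets G → ℝ) := Set.Icc 0 (fun _ => t₀) ∩ {q | indepIncidence G *ᵥ q = fun _ => 1}
  have hK : IsCompact K := by
    refine isCompact_Icc.inter_right (isClosed_eq ?_ continuous_const)
    exact Continuous.matrix_mulVec continuous_const continuous_id
  have hle : ∀ q : IndepSets G → ℝ, (∀ S, 0 ≤ q S) → ∀ S, q S ≤ ∑ S, q S := fun q hq S =>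
    Finset.single_le_sum (fun S _ => hq S) (Finset.mem_univ S)
  have hKne : K.Nonempty := by
    obtain ⟨q, h1, h2, h3⟩ := ht₀
    exact ⟨q, ⟨h2, fun S => (hle q h2 S).trans_eq h3.symm⟩, h1⟩
  obtain ⟨q, ⟨⟨hq0, hqt⟩, hq1⟩, hmin⟩ := hK.exists_isMinOn hKne
    (f := fun q => ∑ S, q S) (by fun_prop)
  have hleast : IsLeast T (∑ S, q S) := by
    refine ⟨⟨q, hq1, hq0, rfl⟩, ?_⟩
    rintro t ⟨q', h1, h2, rfl⟩
    rcases le_total (∑ S, q' S) t₀ with h | h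
    · exact hmin ⟨⟨h2, fun S => (hle q' h2 S).trans h⟩, h1⟩
    · refine le_trans ?_ h
      obtain ⟨q'', h1, h2, rfl⟩ := ht₀
      exact hmin ⟨⟨h2, fun S => hle q'' h2 S⟩, h1⟩
  have : fractionalChromaticNumber G = ∑ S, q S := hleast.csInf_eq
  rw [this]
  exact hleast

end Attained

/-! ### Splitting a load into disjoint families -/

section Packing

open Classical

/-- Nonnegative weights on intervals `[l j, r j]` whose load at every left terminal point is at
most `C` are the marginals of a measure of total mass `C` on the disjoint families of intervals. -/
theorem exists_disjoint_families_of_load_le {V : Type*} (l r : V → ℝ) (hlr : ∀ j, l j ≤ r j)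
    (y : V → ℝ) {C : ℝ} (hC : 0 ≤ C) (W : Finset V) (hy : ∀ j ∈ W, 0 ≤ y j)
    (hload : ∀ j ∈ W, ∑ k ∈ W with l j ∈ Set.Icc (l k) (r k), y k ≤ C) :
    ∃ μ : Finset V → ℝ, (∀ D, 0 ≤ μ D) ∧
      (∀ D ∈ W.powerset, μ D ≠ 0 → (D : Set V).PairwiseDisjoint fun j => Set.Icc (l j) (r j)) ∧
      ∑ D ∈ W.powerset, μ D = C ∧
      ∀ j ∈ W, ∑ D ∈ W.powerset, (if j ∈ D then μ D else 0) = y j := by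
  induction W using Finset.induction_on_max_value l with
  | empty => exact ⟨fun _ => C, fun _ => hC, by simp, by simp, by simp⟩
  | insert j W hj hmax ih =>
    obtain ⟨μ, hμ0, hμd, hμC, hμy⟩ := ih (fun k hk => hy k (Finset.mem_insert_of_mem hk))
      fun k hk => (Finset.sum_le_sum_of_subset_of_nonneg
        (Finset.filter_subset_filter _ (Finset.subset_insert j W))
        fun i hi _ => hy i (Finset.mem_filter.1 hi).1).trans
          (hload k (Finset.mem_insert_of_mem hk))
    -- As `l j` is the largest left end, an interval of `W` meets that of `j` exactly if it contains
    -- `l j`; the free families are those that `j` may join.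
    let free : Finset V → Prop := fun D => ∀ k ∈ D, l j ∉ Set.Icc (l k) (r k)
    have hyj : 0 ≤ y j := hy j (Finset.mem_insert_self j W)
    set m : ℝ := ∑ D ∈ W.powerset, if free D then μ D else 0 with hm
    -- A family that is not free has a member covering `l j`, so the mass of these families is at
    -- most the load of `W` at `l j`.
    have hnotfree : ∑ D ∈ W.powerset, (if free D then 0 else μ D) ≤ C - y j := by
      have h1 : ∑ k ∈ W with l j ∈ Set.Icc (l k) (r k), y k ≤ C - y j := by
        have := hload j (Finset.mem_insert_self j W)
        rw [Finset.filter_insert, if_pos (Set.left_mem_Icc.2 (hlr j)),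
          Finset.sum_insert (by simp [hj])] at this
        linarith
      refine le_trans ?_ h1
      have h2 : ∑ k ∈ W with l j ∈ Set.Icc (l k) (r k), y k = ∑ D ∈ W.powerset,
          ∑ k ∈ W with l j ∈ Set.Icc (l k) (r k), (if k ∈ D then μ D else 0) := by
        rw [Finset.sum_comm]
        exact Finset.sum_congr rfl fun k hk => (hμy k (Finset.mem_filter.1 hk).1).symm
      rw [h2]
      refine Finset.sum_le_sum fun D hD => ?_
      have hnn : ∀ k ∈ W.filter fun k => l j ∈ Set.Icc (l k) (r k),
          0 ≤ if k ∈ D then μ D else 0 := fun k _ => by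
        split_ifs
        exacts [hμ0 D, le_rfl]
      split_ifs with hf
      · exact Finset.sum_nonneg hnn
      · simp only [free, not_forall, not_not] at hf
        obtain ⟨k, hkD, hk⟩ := hf
        have := Finset.single_le_sum hnn
          (Finset.mem_filter.2 ⟨Finset.mem_powerset.1 hD hkD, hk⟩)
        rwa [if_pos hkD] at this
    have hsplit : m + ∑ D ∈ W.powerset, (if free D then 0 else μ D) = C := by
      rw [hm, ← Finset.sum_add_distrib, ← hμC]
      refine Finset.sum_congr rfl fun D _ => ?_
      split_ifs <;> simp
    have hym : y j ≤ m := by linarith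
    obtain ⟨t, ht0, ht1, htm⟩ : ∃ t : ℝ, 0 ≤ t ∧ t ≤ 1 ∧ t * m = y j := by
      rcases (hyj.trans hym).eq_or_lt with h | h
      · exact ⟨0, le_rfl, zero_le_one, by linarith⟩
      · exact ⟨y j / m, div_nonneg hyj h.le, (div_le_one h).2 hym, div_mul_cancel₀ _ h.ne'⟩
    -- The share `t` of each free family is moved to the same family with `j` added. This mass is `t
    -- * m = y j`, and the marginals on `W` do not change.
    let ν : Finset V → ℝ := fun D =>
      if j ∈ D then (if free (D.erase j) then t * μ (D.erase j) else 0)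
      else (if free D then (1 - t) * μ D else μ D)
    have hν1 : ∀ D ∈ W.powerset, ν (insert j D) = if free D then t * μ D else 0 := by
      intro D hD
      have hjD : j ∉ D := fun h => hj (Finset.mem_powerset.1 hD h)
      simp only [ν, Finset.mem_insert_self, if_true, Finset.erase_insert hjD]
    have hν2 : ∀ D ∈ W.powerset, ν D = if free D then (1 - t) * μ D else μ D := by
      intro D hD
      have hjD : j ∉ D := fun h => hj (Finset.mem_powerset.1 hD h)
      simp only [ν, if_neg hjD]
    have hadd : ∀ D ∈ W.powerset, ν D + ν (insert j D) = μ D := by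
      intro D hD
      rw [hν1 D hD, hν2 D hD]
      split_ifs <;> ring
    refine ⟨ν, ?_, ?_, ?_, ?_⟩
    · intro D
      have := hμ0 D
      have := hμ0 (D.erase j)
      have : 0 ≤ 1 - t := by linarith
      simp only [ν]
      split_ifs <;> positivity
    · intro D hD hνD
      by_cases hjD : j ∈ D
      · obtain ⟨D, hj', rfl⟩ : ∃ D', j ∉ D' ∧ insert j D' = D :=
          ⟨D.erase j, Finset.notMem_erase j D, Finset.insert_erase hjD⟩
        have hDW : D ∈ W.powerset := Finset.mem_powerset.2 fun k hk =>
          (Finset.mem_insert.1 (Finset.mem_powerset.1 hD (Finset.mem_insert_of_mem hk))).resolve_left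
            (by rintro rfl; exact hj' hk)
        rw [hν1 D hDW] at hνD
        have hf : free D := by
          by_contra h
          exact hνD (if_neg h)
        rw [if_pos hf] at hνD
        rw [Finset.coe_insert]
        refine (hμd D hDW (right_ne_zero_of_mul hνD)).insert fun k hk _ => ?_
        refine Set.disjoint_left.2 fun p hpj hpk => hf k hk ?_
        exact ⟨hmax k (Finset.mem_powerset.1 hDW hk), hpj.1.trans hpk.2⟩
      · have hDW : D ∈ W.powerset := Finset.mem_powerset.2
          ((Finset.subset_insert_iff_of_notMem hjD).1 (Finset.mem_powerset.1 hD))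
        refine hμd D hDW fun h => hνD ?_
        rw [hν2 D hDW, h]
        simp
    · rw [Finset.sum_powerset_insert hj, ← Finset.sum_add_distrib, Finset.sum_congr rfl hadd, hμC]
    · intro k hk
      rw [Finset.sum_powerset_insert hj, ← Finset.sum_add_distrib]
      rcases Finset.mem_insert.1 hk with rfl | hkW
      · rw [← htm, hm, Finset.mul_sum]
        refine Finset.sum_congr rfl fun D hD => ?_
        have hjD : k ∉ D := fun h => hj (Finset.mem_powerset.1 hD h)
        rw [if_neg hjD, if_pos (Finset.mem_insert_self k D), hν1 D hD]
        simp
      · rw [← hμy k hkW]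
        refine Finset.sum_congr rfl fun D hD => ?_
        have hkj : k ≠ j := by
          rintro rfl
          exact hj hkW
        rw [← hadd D hD]
        simp only [Finset.mem_insert, hkj, false_or]
        split_ifs <;> simp

end Packing

/-! ### Independence in product measures -/

section ProductWeights

variable {κ α : Type*} [Fintype κ] [DecidableEq κ]

theorem prod_update_mul (μ : κ → α → ℝ) (i : κ) (f : κ → α) (d : α) :
    (∏ k, μ k (Function.update f i d k)) * μ i (f i) = (∏ k, μ k (f k)) * μ i d := by
  rw [← Finset.mul_prod_erase _ _ (Finset.mem_univ i),
    ← Finset.mul_prod_erase _ (fun k => μ k (f k)) (Finset.mem_univ i), Function.update_self,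
    Finset.prod_congr rfl fun k hk => by rw [Function.update_of_ne (Finset.ne_of_mem_erase hk)]]
  ring

/-- In a product measure, an observable that does not depend on the coordinate `i` is independent
of every observable of the coordinate `i`. -/
theorem sum_prod_mul_of_forall_update [Fintype α] (μ : κ → α → ℝ) (i : κ)
    (g : (κ → α) → ℝ)
    (hg : ∀ f d, g (Function.update f i d) = g f) (h : α → ℝ) :
    (∑ f : κ → α, (∏ k, μ k (f k)) * g f * h (f i)) * ∑ d, μ i d
      = (∑ f : κ → α, (∏ k, μ k (f k)) * g f) * ∑ d, μ i d * h d := by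
  rw [Finset.sum_mul_sum, Finset.sum_mul_sum, ← Finset.sum_product', ← Finset.sum_product']
  -- Exchanging `f i` with the independent copy `d` is an involution on the pairs that preserves the
  -- weight and `g`.
  refine Finset.sum_nbij' (fun p => (Function.update p.1 i p.2, p.1 i))
    (fun p => (Function.update p.1 i p.2, p.1 i)) (by simp) (by simp) (by simp) (by simp) ?_
  rintro ⟨f, d⟩ -
  simp only [hg]
  linear_combination (-(g f * h (f i))) * prod_update_mul μ i f d

end ProductWeights

namespace IntervalRepresentation

/-! ### From solutions of LR to fractional colorings -/

section LRToColoring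

open Classical

variable {V : Type*} {G : SimpleGraph V} (R : IntervalRepresentation G)

/-- The set represented by a node of `Γ`: the whole line for the root, `I i` for a vertex `i`. -/
def nodeSet (i : Option V) : Set ℝ := i.elim Set.univ R.I

theorem isArc_iff {i : Option V} {j : V} : R.IsArc i j ↔ R.I j ⊂ R.nodeSet i := by
  cases i with
  | none =>
    refine iff_of_true trivial (Set.ssubset_univ_iff.2 fun h => ?_)
    have : R.r j + 1 ∈ R.I j := h ▸ Set.mem_univ _
    linarith [this.2]
  | some i => rfl

/-- A choice of children `f i` for every node `i` of `Γ`, such that the chosen children of a node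
are pairwise disjoint intervals contained in it. -/
structure IsChoice (f : Option V → Finset V) : Prop where
  isArc : ∀ i, ∀ j ∈ f i, R.IsArc i j
  disjoint : ∀ i, (f i : Set V).PairwiseDisjoint R.I

/-- `k` is a chosen child of `i`. -/
def Child (f : Option V → Finset V) (i k : Option V) : Prop :=
  ∃ j, k = some j ∧ R.IsArc i j ∧ j ∈ f i

/-- `k` is a descendant of `i` with respect to chosen children. -/
def Desc (f : Option V → Finset V) : Option V → Option V → Prop :=
  Relation.ReflTransGen (R.Child f)

variable {R}

theorem Child.nodeSet_ssubset {f : Option V → Finset V} {i k : Option V} (h : R.Child f i k) :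
    R.nodeSet k ⊂ R.nodeSet i := by
  obtain ⟨j, rfl, hj, -⟩ := h
  exact R.isArc_iff.1 hj

theorem Desc.nodeSet_subset {f : Option V → Finset V} {i k : Option V} (h : R.Desc f i k) :
    R.nodeSet k ⊆ R.nodeSet i := by
  induction h with
  | refl => exact subset_rfl
  | tail _ h ih => exact h.nodeSet_ssubset.subset.trans ih

theorem IsChoice.child_disjoint {f : Option V → Finset V} (hf : R.IsChoice f) {i j k : Option V}
    (hj : R.Child f i j) (hk : R.Child f i k) (hjk : j ≠ k) :
    Disjoint (R.nodeSet j) (R.nodeSet k) := by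
  obtain ⟨j, rfl, -, hj⟩ := hj
  obtain ⟨k, rfl, -, hk⟩ := hk
  exact hf.disjoint i hj hk fun h => hjk (congrArg some h)

/-- Two nodes that are reached from the root are comparable or disjoint. -/
theorem IsChoice.desc_or_disjoint {f : Option V → Finset V} (hf : R.IsChoice f) {j k : Option V}
    (hj : R.Desc f none j) (hk : R.Desc f none k) :
    R.Desc f j k ∨ R.Desc f k j ∨ Disjoint (R.nodeSet j) (R.nodeSet k) := by
  induction hk with
  | refl => exact .inr (.inl hj)
  | @tail m k _ hmk ih =>
    rcases ih with h | h | h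
    · exact .inl (h.tail hmk)
    · rcases Relation.ReflTransGen.cases_head h with rfl | ⟨a, hma, haj⟩
      · exact .inl (.single hmk)
      · by_cases hak : a = k
        · exact .inr (.inl (hak ▸ haj))
        · exact .inr (.inr ((hf.child_disjoint hma hmk hak).mono_left (Desc.nodeSet_subset haj)))
    · exact .inr (.inr (h.mono_right hmk.nodeSet_ssubset.subset))

/-- Otherwise the path from `i` to `k` starts with a child `a` of `i`. If `a` is `j`, then `k` both
strictly contains `j` and lies within it; if not, `a` is disjoint from `j` and yet contains it. -/
theorem IsChoice.eq_of_desc {f : Option V → Finset V} (hf : R.IsChoice f) {i k : Option V} {j : V}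
    (hi : R.Child f i (some j)) (hk : R.Child f k (some j)) (hik : R.Desc f i k) : i = k := by
  rcases Relation.ReflTransGen.cases_head hik with h | ⟨a, hia, hak⟩
  · exact h
  · exfalso
    have hjk := hk.nodeSet_ssubset
    have hka := Desc.nodeSet_subset hak
    by_cases haj : a = some j
    · subst haj
      exact hjk.not_subset hka
    · exact Set.disjoint_left.1 (hf.child_disjoint hia hi haj)
        (hka (hjk.subset (R.left_mem_I j))) (R.left_mem_I j)

/-- A vertex is a child of at most one node reached from the root. -/
theorem IsChoice.parent_unique {f : Option V → Finset V} (hf : R.IsChoice f) {i k : Option V}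
    {j : V} (hi : R.Desc f none i) (hk : R.Desc f none k) (hij : R.Child f i (some j))
    (hkj : R.Child f k (some j)) : i = k := by
  rcases hf.desc_or_disjoint hi hk with h | h | h
  · exact hf.eq_of_desc hij hkj h
  · exact (hf.eq_of_desc hkj hij h).symm
  · exact absurd (hkj.nodeSet_ssubset.subset (R.left_mem_I j))
      (Set.disjoint_left.1 h (hij.nodeSet_ssubset.subset (R.left_mem_I j)))

/-- Sets shrink along a path, so if the path to `k` used a choice of `i`, then `i` would strictly
contain `k`. -/
theorem desc_update {f : Option V → Finset V} {i : Option V} (D : Finset V) {k : Option V}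
    (hk : R.Desc f none k) (hik : ∀ k' ∈ k, ¬ R.IsArc i k') :
    R.Desc (Function.update f i D) none k := by
  induction hk with
  | refl => exact .refl
  | @tail m k _ hmk ih =>
    obtain ⟨j, rfl, hmj, hj⟩ := hmk
    have hi : ¬ R.IsArc i j := hik j rfl
    have hmi : m ≠ i := by
      rintro rfl
      exact hi hmj
    refine (ih ?_).tail ⟨j, rfl, hmj, by rwa [Function.update_of_ne hmi]⟩
    rintro m' rfl him
    rw [isArc_iff] at hi him
    exact hi (ssubset_trans hmj him)

/-- Whether `i` is reached from the root does not depend on the children chosen for `i`. -/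
theorem desc_update_iff (f : Option V → Finset V) (i : Option V) (D : Finset V) :
    R.Desc (Function.update f i D) none i ↔ R.Desc f none i := by
  have hi : ∀ k' ∈ i, ¬ R.IsArc i k' := by
    rintro k rfl
    exact ssubset_irrefl _
  refine ⟨fun h => ?_, fun h => desc_update D h hi⟩
  -- Updating once more with the old value `f i` restores `f`.
  simpa using desc_update (f i) h hi

variable [Fintype V]

variable (R) in
/-- The set of the vertices that are reached from the root. -/
noncomputable def reached (f : Option V → Finset V) : Finset V :=
  Finset.univ.filter fun j => R.Desc f none (some j)

theorem IsChoice.isIndepSet_reached {f : Option V → Finset V} (hf : R.IsChoice f) :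
    G.IsIndepSet (R.reached f : Set V) := by
  intro i hi j hj hij
  simp only [reached, Finset.coe_filter, Finset.mem_univ, true_and, Set.mem_ofPred_eq] at hi hj
  refine R.not_adj_iff.2 fun hne => .inr ?_
  have hne' : R.I i ≠ R.I j := R.I_injective.ne hij
  rcases hf.desc_or_disjoint hi hj with h | h | h
  · exact .inr (lt_of_le_of_ne h.nodeSet_subset hne'.symm)
  · exact .inl (lt_of_le_of_ne h.nodeSet_subset hne')
  · exact absurd h (Set.not_disjoint_iff_nonempty_inter.2 hne)

/-- A reached vertex is chosen by exactly one reached node, so the event splits disjointly by parent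
and can be averaged term by term. -/
theorem IsChoice.sum_parents_eq {f : Option V → Finset V} (hf : R.IsChoice f) (j : V) :
    ∑ i : Option V, (if R.Desc f none i then (1 : ℝ) else 0) * (if j ∈ f i then 1 else 0)
      = if R.Desc f none (some j) then 1 else 0 := by
  have hterm : ∀ i, (if R.Desc f none i then (1 : ℝ) else 0) * (if j ∈ f i then 1 else 0)
      = if R.Desc f none i ∧ R.Child f i (some j) then 1 else 0 := by
    intro i
    have : R.Child f i (some j) ↔ j ∈ f i := by
      constructor
      · rintro ⟨k, hk, -, h⟩
        obtain rfl := Option.some.inj hk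
        exact h
      · exact fun h => ⟨j, rfl, hf.isArc i j h, h⟩
    rw [this, ite_and]
    split_ifs <;> simp
  rw [Finset.sum_congr rfl fun i _ => hterm i]
  split_ifs with h
  · obtain ⟨i, hi, hij⟩ : ∃ i, R.Desc f none i ∧ R.Child f i (some j) := by
      rcases Relation.ReflTransGen.cases_tail h with h | h
      · simp at h
      · exact h
    rw [Finset.sum_eq_single i]
    · rw [if_pos ⟨hi, hij⟩]
    · intro k _ hki
      exact if_neg fun hk => hki (hf.parent_unique hk.1 hi hk.2 hij)
    · simp
  · exact Finset.sum_eq_zero fun i _ => if_neg fun hi => h (hi.1.tail hi.2)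

variable (R)

theorem vertex_induction {P : V → Prop} (h : ∀ j, (∀ i, R.I j ⊂ R.I i → P i) → P j) (j : V) :
    P j := by
  have hwf : WellFounded fun i j : V => R.I j ⊂ R.I i :=
    haveI : IsTrans V fun i j => R.I j ⊂ R.I i := ⟨fun _ _ _ h1 h2 => ssubset_trans h2 h1⟩
    haveI : Std.Irrefl fun i j : V => R.I j ⊂ R.I i := ⟨fun _ => ssubset_irrefl _⟩
    Finite.wellFounded_of_trans_of_irrefl _
  exact hwf.induction j h

/-- A random choice of children with the given marginals reaches every vertex with
probability `1` (where the total mass at the root need not be `1`). -/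
theorem sum_weight_reached_eq_one (μ : Option V → Finset V → ℝ)
    (harc : ∀ i D, μ i D ≠ 0 → ∀ j ∈ D, R.IsArc i j)
    (hchoice : ∀ f : Option V → Finset V, ∏ k, μ k (f k) ≠ 0 → R.IsChoice f)
    (hmass : ∀ i : V, ∑ D, μ (some i) D = 1)
    (hpar : ∀ j, ∑ i, ∑ D, μ i D * (if j ∈ D then 1 else 0) = 1) (j : V) :
    ∑ f : Option V → Finset V,
      (∏ k, μ k (f k)) * (if R.Desc f none (some j) then 1 else 0) = 1 := by
  induction j using R.vertex_induction with
  | h j ih =>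
  have h1 : ∀ f : Option V → Finset V,
      (∏ k, μ k (f k)) * (if R.Desc f none (some j) then 1 else 0) = ∑ i : Option V,
        (∏ k, μ k (f k)) * (if R.Desc f none i then (1 : ℝ) else 0)
          * (if j ∈ f i then 1 else 0) := by
    intro f
    by_cases h0 : ∏ k, μ k (f k) = 0
    · simp [h0]
    · simp only [mul_assoc]
      rw [← Finset.mul_sum, (hchoice f h0).sum_parents_eq]
  rw [Finset.sum_congr rfl fun f _ => h1 f, Finset.sum_comm]
  refine Eq.trans ?_ (hpar j)
  refine Finset.sum_congr rfl fun i _ => ?_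
  cases i with
  | none =>
    -- The root is always reached, but its mass is not normalized; instead of using independence,
    -- the sum is factored over the nodes, and all vertices contribute 1.
    have h2 : ∀ f : Option V → Finset V, (∏ k, μ k (f k))
        * (if R.Desc f none none then (1 : ℝ) else 0) * (if j ∈ f none then 1 else 0)
        = ∏ k : Option V, μ k (f k) * (if k = none ∧ j ∉ f k then 0 else 1) := by
      intro f
      rw [if_pos (show R.Desc f none none from .refl), mul_one, Finset.prod_mul_distrib]
      congr 1
      simp [Fintype.prod_option]
    rw [Finset.sum_congr rfl fun f _ => h2 f,
      ← Fintype.prod_sum fun k D => μ k D * (if k = none ∧ j ∉ D then 0 else 1),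
      Fintype.prod_option]
    simp [hmass]
  | some i =>
    have h2 := sum_prod_mul_of_forall_update μ (some i)
      (fun f => if R.Desc f none (some i) then (1 : ℝ) else 0)
      (fun f D => by simp only [desc_update_iff]) (fun D => if j ∈ D then 1 else 0)
    rw [hmass, mul_one] at h2
    rw [h2]
    -- If `i` contains `j`, the induction hypothesis says that `i` is reached with weight 1; if not,
    -- `i` never chooses `j`.
    by_cases hij : R.I j ⊂ R.I i
    · rw [ih i hij, one_mul]
    · have h3 : ∑ D, μ (some i) D * (if j ∈ D then 1 else 0) = 0 := by
        refine Finset.sum_eq_zero fun D _ => ?_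
        by_cases hD : μ (some i) D = 0
        · rw [hD, zero_mul]
        · rw [if_neg fun hj => hij (harc _ D hD j hj), mul_zero]
      rw [h3, mul_zero]

/-- The value of `x` at the pair `(i, j)`, and `0` if `(i, j)` is not an arc. -/
noncomputable def arcValue (x : R.Arc → ℝ) (i : Option V) (j : V) : ℝ :=
  if h : R.IsArc i j then x ⟨(i, j), h⟩ else 0

theorem subM_mulVec_subvec_eq_sum_arcValue (x : R.Arc → ℝ) (i : Option V) (p : R.Terminal) :
    (R.subM i *ᵥ R.subvec x i) p
      = ∑ k ∈ Finset.univ.filter (R.IsArc i) with p.1 ∈ R.I k, R.arcValue x i k := by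
  rw [Finset.sum_filter, Finset.sum_subtype (p := R.IsArc i) _ (by simp)]
  refine Finset.sum_congr rfl fun j _ => ?_
  simp [subM, subvec, M, arcValue, j.2]

theorem sum_arcValue_eq (x : R.Arc → ℝ) (j : V) :
    ∑ i, R.arcValue x i j = ∑ a : R.Arc with a.1.2 = j, x a := by
  have : ∀ i, R.arcValue x i j
      = ∑ a : R.Arc, if a.1.1 = i then (if a.1.2 = j then x a else 0) else 0 := by
    intro i
    rw [R.sum_arc_eq_sum_out i (fun a => if a.1.2 = j then x a else 0)]
    by_cases h : R.IsArc i j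
    · rw [Finset.sum_eq_single ⟨j, h⟩]
      · simp [arcValue, h]
      · intro k _ hk
        exact if_neg fun hkj => hk (Subtype.ext hkj)
      · simp
    · rw [arcValue, dif_neg h, Finset.sum_eq_zero]
      rintro ⟨k, hk⟩ -
      refine if_neg ?_
      rintro rfl
      exact h hk
  rw [Finset.sum_congr rfl fun i _ => this i, Finset.sum_comm, Finset.sum_filter]
  simp

/-- The arcs leaving a node `i` in a feasible solution of LR are the marginals of a measure on the
disjoint families of intervals in `Vⁱ`, of total mass `c` for the root and `1` for a vertex. -/
theorem exists_node_measure {x : R.Arc → ℝ} {c : ℝ} (hx : R.IsLRFeasible x c) (i : Option V) :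
    ∃ μ : Finset V → ℝ, (∀ D, 0 ≤ μ D) ∧
      (∀ D, μ D ≠ 0 → (∀ j ∈ D, R.IsArc i j) ∧ (D : Set V).PairwiseDisjoint R.I) ∧
      ∑ D, μ D = i.elim c (fun _ => 1) ∧
      ∀ j, ∑ D, μ D * (if j ∈ D then 1 else 0) = R.arcValue x i j := by
  set W : Finset V := Finset.univ.filter (R.IsArc i) with hW
  obtain ⟨μ, hμ0, hμd, hμC, hμy⟩ := exists_disjoint_families_of_load_le R.l R.r
    (fun j => (R.l_lt_r j).le) (R.arcValue x i) (C := i.elim c (fun _ => 1))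
    (by cases i; exacts [hx.c_nonneg, zero_le_one]) W
    (fun j _ => by
      unfold arcValue
      split_ifs
      exacts [hx.x_nonneg _, le_rfl])
    -- The load at `l j` is the row of LR at this terminal point. For a vertex `i` that row is
    -- present because `j` is the head of an arc leaving `i`.
    (fun j hj => by
      have h := R.subM_mulVec_subvec_eq_sum_arcValue x i ⟨R.l j, .inl ⟨j, rfl⟩⟩
      refine le_of_eq_of_le (Eq.trans ?_ h.symm) ?_
      · exact Finset.sum_congr (by ext; simp [hW, I]) fun _ _ => rfl
      cases i with
      | none => exact hx.root _
      | some i => exact hx.inner ⟨i, ⟨⟨j, (Finset.mem_filter.1 hj).2⟩⟩⟩ _)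
  have hsum : ∀ g : Finset V → ℝ, ∑ D, (if D ∈ W.powerset then g D else 0)
      = ∑ D ∈ W.powerset, g D := fun g => by
    rw [← Finset.sum_filter, Finset.filter_mem_eq_inter, Finset.univ_inter]
  refine ⟨fun D => if D ∈ W.powerset then μ D else 0, fun D => ?_, fun D hD => ?_, ?_, fun j => ?_⟩
  · dsimp only
    split_ifs
    exacts [hμ0 D, le_rfl]
  · have hDW : D ∈ W.powerset := by
      by_contra h
      exact hD (if_neg h)
    simp only [if_pos hDW] at hD
    exact ⟨fun j hj => (Finset.mem_filter.1 (Finset.mem_powerset.1 hDW hj)).2, hμd D hDW hD⟩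
  · rw [hsum, hμC]
  · simp only [ite_mul, zero_mul]
    rw [hsum fun D => μ D * (if j ∈ D then 1 else 0)]
    by_cases hj : j ∈ W
    · simpa using hμy j hj
    · rw [arcValue, dif_neg (by simpa [hW] using hj), Finset.sum_eq_zero]
      intro D hD
      rw [if_neg fun h => hj (Finset.mem_powerset.1 hD h), mul_zero]

/-- A feasible solution of LR of value `c` yields a fractional coloring of weight `c`. -/
theorem exists_fractional_coloring {x : R.Arc → ℝ} {c : ℝ} (hx : R.IsLRFeasible x c) :
    ∃ q : IndepSets G → ℝ, indepIncidence G *ᵥ q = (fun _ => 1) ∧ (∀ S, 0 ≤ q S) ∧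
      c = ∑ S, q S := by
  choose μ hμ0 hμs hμC hμy using fun i => R.exists_node_measure hx i
  have hchoice : ∀ f : Option V → Finset V, ∏ k, μ k (f k) ≠ 0 → R.IsChoice f := fun f hf => by
    rw [Finset.prod_ne_zero_iff] at hf
    exact ⟨fun i => (hμs i _ (hf i (Finset.mem_univ i))).1,
      fun i => (hμs i _ (hf i (Finset.mem_univ i))).2⟩
  have hreach := R.sum_weight_reached_eq_one μ (fun i D hD => (hμs i D hD).1) hchoice
    (fun i => hμC (some i)) fun j => by
      rw [Finset.sum_congr rfl fun i _ => hμy i j, R.sum_arcValue_eq, hx.parent]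
  -- A choice of nonzero weight contributes to exactly one independent set, the one it reaches.
  have hcollapse : ∀ (f : Option V → Finset V) (g : Finset V → ℝ),
      ∑ S : IndepSets G, g S.1 * (if R.reached f = S.1 then ∏ k, μ k (f k) else 0)
        = (∏ k, μ k (f k)) * g (R.reached f) := by
    intro f g
    by_cases h0 : ∏ k, μ k (f k) = 0
    · simp [h0]
    · rw [Finset.sum_eq_single ⟨R.reached f, (hchoice f h0).isIndepSet_reached⟩]
      · simp [mul_comm]
      · intro S _ hS
        rw [if_neg fun h => hS (Subtype.ext h.symm), mul_zero]
      · simp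
  refine ⟨fun S => ∑ f : Option V → Finset V, if R.reached f = S.1 then ∏ k, μ k (f k) else 0,
    ?_, fun S => Finset.sum_nonneg fun f _ => ?_, ?_⟩
  · ext v
    refine Eq.trans ?_ (hreach v)
    simp only [Matrix.mulVec, dotProduct, Finset.mul_sum, indepIncidence]
    rw [Finset.sum_comm]
    refine Finset.sum_congr rfl fun f _ => ?_
    rw [hcollapse f fun S => if v ∈ S then 1 else 0]
    simp [reached]
  · split_ifs
    exacts [Finset.prod_nonneg fun k _ => hμ0 k _, le_rfl]
  · rw [Finset.sum_comm]
    have h1 : ∀ f : Option V → Finset V,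
        ∑ S : IndepSets G, (if R.reached f = S.1 then ∏ k, μ k (f k) else 0)
          = ∏ k, μ k (f k) := fun f => by
      simpa using hcollapse f fun _ => 1
    -- The total mass is the product of the masses of the nodes: `c` from the root and 1 from each
    -- vertex.
    rw [Finset.sum_congr rfl fun f _ => h1 f, ← Fintype.prod_sum, Fintype.prod_option]
    simp [hμC]

end LRToColoring

end IntervalRepresentation

/-! ### The main theorem -/

theorem mainTheorem4 {V : Type*} [Fintype V] (G : SimpleGraph V) :
    -- circle graphs are exactly the graphs with an interval representation
    (IsCircleGraph G ↔ Nonempty (IntervalRepresentation G)) ∧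
    ∀ R : IntervalRepresentation G,
      -- the optimal value of LR is attained and equals the fractional chromatic number
      IsLeast {c : ℝ | ∃ x : R.Arc → ℝ, R.IsLRFeasible x c} (fractionalChromaticNumber G) ∧
      -- LR is a linear program of polynomial size
      (∀ z : Option R.Arc → ℝ,
        (R.lrProgram.IsFeasible z ↔ R.IsLRFeasible (fun a => z (some a)) (z none)) ∧
        ∑ v, R.lrProgram.cost v * z v = z none) ∧
      R.lrProgram.HasUnitData ∧
      2 * Nat.card (Option R.Arc) ≤ Fintype.card V * (Fintype.card V + 1) + 2 ∧
      Nat.card (Option R.Inner × R.Terminal) + Nat.card V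
        ≤ 2 * Fintype.card V ^ 2 + Fintype.card V := by
  refine ⟨⟨nonempty_intervalRepresentation_of_isCircleGraph,
    fun ⟨R⟩ => isCircleGraph_of_intervalRepresentation R⟩, fun R => ⟨?_, fun z =>
      ⟨R.isFeasible_lrProgram_iff z, R.sum_lrProgram_cost_mul z⟩, R.hasUnitData_lrProgram,
      R.two_mul_card_arc_le, R.card_constraints_le⟩⟩
  obtain ⟨⟨q, hq, hq0, hsum⟩, hle⟩ := isLeast_fractionalChromaticNumber G
  constructor
  · rw [hsum]
    exact R.exists_isLRFeasible q hq hq0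
  · rintro c ⟨x, hx⟩
    exact hle (R.exists_fractional_coloring hx)
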